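/- Let $p$ be a prime, let $K_{\mathfrak p}$ be a finite extension of $\mathbb{Q}_p$ (with the absolute value extending $|\cdot|_p$), let $\mathcal{O}_{\mathfrak p}=\{x\in K_{\mathfrak p}: |x|\le 1\}$ be its ring of integers, $\mathfrak p$ the maximal ideal of $\mathcal{O}_{\mathfrak p}$, and $r$ a uniformizing element, i.e. $\mathfrak p=r\mathcal{O}_{\mathfrak p}$. Let $\phi_1,\dots,\phi_n\in\mathcal{O}_{\mathfrak p}[[x_1,\dots,x_n]]$ be power series, convergent on $\mathcal{O}_{\mathfrak p}^n$, such that $\phi_i(x)\equiv x_i \pmod{\mathfrak p}$ for all $x\in\mathcal{O}_{\mathfrak p}^n$ and all $i$, and such that the coefficient of $x_1^{k_1}\cdots x_n^{k_n}$ in $\phi_i$ is divisible by $r^{k_1+\dots+k_n-1}$ whenever $k_1+\dots+k_n>1$. Let $(\omega_1,\dots,\omega_n)\in\mathcal{O}_{\mathfrak p}^n$. Then there exist continuous functions $g_1,\dots,g_n:\mathbb{Z}_p\to\mathcal{O}_{\mathfrak p}$ and a positive integer $l$ such that, for every $i$, $$g_i(0)=\omega_i,\qquad g_i(z+1)=\phi_i(g_1(z),\dots,g_n(z))\quad\text{for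 all } z\in\mathbb{Z}_p,$$ and $g_i$ is analytic on $p^l\mathbb{Z}_p$, i.e. there are $a_{i,m}\in K_{\mathfrak p}$ $(m\ge 0)$ such that $g_i(z)=\sum_{m\ge 0}a_{i,m}z^m$, with the series converging, for every $z\in p^l\mathbb{Z}_p$. -/

import Mathlib

open Topology

noncomputable section

namespace PadicArc

/-- The norm of a normed field extension of `ℚ_[p]` is automatically nonarchimedean. -/
theorem isUltrametricDist (p : ℕ) [Fact p.Prime] (L : Type*) [NormedField L]
    [NormedAlgebra ℚ_[p] L] : IsUltrametricDist L := by
  refine IsUltrametricDist.isUltrametricDist_of_forall_norm_natCast_le_one fun m => ?_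
  have h : ((m : ℚ_[p]) : ℚ_[p]) = ((m : ℤ_[p]) : ℚ_[p]) := by simp
  rw [← map_natCast (algebraMap ℚ_[p] L) m, norm_algebraMap', h]
  exact PadicInt.norm_le_one _

/-- The ring of integers `{x ∈ L : |x| ≤ 1}` of an extension `L` of `ℚ_[p]`. -/
def integers (p : ℕ) [Fact p.Prime] (L : Type*) [NormedField L] [NormedAlgebra ℚ_[p] L] :
    Subring L where
  carrier := {x | ‖x‖ ≤ 1}
  mul_mem' {a b} ha hb := by
    change ‖a * b‖ ≤ 1
    rw [norm_mul]
    exact mul_le_one₀ ha (norm_nonneg b) hb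
  one_mem' := by simp
  add_mem' {a b} ha hb := by
    have := isUltrametricDist p L
    exact (IsUltrametricDist.norm_add_le_max a b).trans (max_le ha hb)
  zero_mem' := by simp
  neg_mem' {a} ha := by simpa using ha

variable {p : ℕ} [Fact p.Prime] {L : Type*} [NormedField L] [NormedAlgebra ℚ_[p] L]

theorem norm_le_one (x : integers p L) : ‖(x : L)‖ ≤ 1 := x.2

theorem isUnit_iff_norm_eq_one (x : integers p L) : IsUnit x ↔ ‖(x : L)‖ = 1 := by
  constructor
  · rintro ⟨u, rfl⟩
    have h : ‖((u : integers p L) : L)‖ * ‖((u⁻¹ : (integers p L)ˣ) : L)‖ = 1 := by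
      rw [← norm_mul, ← Subring.coe_mul, Units.mul_inv]
      simp
    have h1 := norm_le_one (u : integers p L)
    have h2 := norm_le_one ((u⁻¹ : (integers p L)ˣ) : integers p L)
    nlinarith [norm_nonneg ((u : integers p L) : L)]
  · intro h
    have h0 : (x : L) ≠ 0 := by
      intro h0
      simp [h0] at h
    refine IsUnit.of_mul_eq_one ⟨(x : L)⁻¹, ?_⟩ (Subtype.ext ?_)
    · change ‖(x : L)⁻¹‖ ≤ 1
      simp [h]
    · simp [h0]

instance : IsLocalRing (integers p L) :=
  IsLocalRing.of_nonunits_add fun a b ha hb => by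
    have := isUltrametricDist p L
    rw [mem_nonunits_iff, isUnit_iff_norm_eq_one] at *
    refine ne_of_lt ((IsUltrametricDist.norm_add_le_max (a : L) (b : L)).trans_lt ?_)
    exact max_lt (lt_of_le_of_ne (norm_le_one a) ha) (lt_of_le_of_ne (norm_le_one b) hb)

/-- `r` is a uniformizing element: it generates the maximal ideal of the ring of integers. -/
def IsUniformizer (r : integers p L) : Prop :=
  IsLocalRing.maximalIdeal (integers p L) = Ideal.span {r}

/-- The term of the power series `f` with exponent `k`, evaluated at the point `x`. -/
def term {n : ℕ} (f : MvPowerSeries (Fin n) (integers p L)) (x : Fin n → integers p L)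
    (k : Fin n →₀ ℕ) : integers p L :=
  MvPowerSeries.coeff k f * ∏ j, x j ^ k j

/-- The power series `f` converges at every point with integral coordinates. -/
def Converges {n : ℕ} (f : MvPowerSeries (Fin n) (integers p L)) : Prop :=
  ∀ x : Fin n → integers p L, Summable (term f x)

/-- The value at `x` of a convergent power series `f`. -/
def eval {n : ℕ} (f : MvPowerSeries (Fin n) (integers p L)) (x : Fin n → integers p L) :
    integers p L :=
  ∑' k, term f x k

/-- `g` is given on `p ^ l ℤ_[p]` by one power series in `z` with coefficients in `L`,
convergent on all of `p ^ l ℤ_[p]`. -/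
def AnalyticOnPow (l : ℕ) (g : ℤ_[p] → integers p L) : Prop :=
  ∃ a : ℕ → L, ∀ z ∈ Ideal.span {(p : ℤ_[p]) ^ l},
    HasSum (fun m => a m * algebraMap ℚ_[p] L (z : ℚ_[p]) ^ m) (g z : L)

end PadicArc

end

noncomputable section

namespace PadicArc

open scoped fwdDiff
open Filter

/-! ### Operators congruent to the identity modulo `r` -/

section Unipotent

variable {R M : Type*} [CommRing R] [AddCommGroup M] [Module R M]

/-! Integrality and the congruence at points force `φ` to be the identity modulo `r`
coefficientwise. For a polynomial map `P` with this property, let `S` be composition with `P`. Then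
`S - 1` is divisible by `r`, and since `r ∣ p`, `S ^ p ^ l - 1` is divisible by `r ^ (l + 1)`. The
`k`-th difference of the orbit sampled along `p ^ l ℕ` is a value of `(S ^ p ^ l - 1) ^ k X_i`,
hence divisible by `r ^ ((l + 1) * k)` (`pow_dvd_fwdDiff_iter_polynomial_orbit`). Polynomial
approximation carries the bound to `φ` (`norm_fwdDiff_iter_orbit_le`).

By Mahler, the orbit (`l = 0`) extends continuously to `ℤ_[p]`. For large `l` the decay beats the
denominators `k!`, so the sampled orbit is a power series (`exists_hasSum_pow_of_mahler`). Density
of `ℕ` gives the functional equation. -/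

theorem pow_sub_self_eq_smul {S : Module.End R M} {r : R} (hS : ∀ f, ∃ h, S f - f = r • h)
    (i : ℕ) (f : M) : ∃ h, (S ^ i) f - f = r • h := by
  induction i generalizing f with
  | zero => exact ⟨0, by simp⟩
  | succ i ih =>
    obtain ⟨h, hh⟩ := hS f
    obtain ⟨h', hh'⟩ := ih (S f)
    refine ⟨h' + h, ?_⟩
    rw [pow_succ, Module.End.mul_apply, smul_add, ← hh, ← hh']
    abel

/-- Factor `S ^ q - 1 = (S - 1) ∑ S ^ i`: modulo `r` the sum is `q`, hence zero, which gains one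
factor `r`. -/
theorem pow_sub_self_eq_pow_succ_smul {S : Module.End R M} {r : R} {q a : ℕ} (hq : r ∣ (q : R))
    (hS : ∀ f, ∃ h, S f - f = r ^ (a + 1) • h) (f : M) :
    ∃ h, (S ^ q) f - f = r ^ (a + 2) • h := by
  obtain ⟨c, hc⟩ := hq
  have hS' : ∀ f, ∃ h, S f - f = r • h := fun f => by
    obtain ⟨h, hh⟩ := hS f
    exact ⟨r ^ a • h, by rw [hh, pow_succ', mul_smul]⟩
  choose h hh using fun i => pow_sub_self_eq_smul hS' i f
  have hsum : (∑ i ∈ Finset.range q, S ^ i) f = r • (c • f + ∑ i ∈ Finset.range q, h i) := by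
    have : ∀ i, (S ^ i) f = f + r • h i := fun i => by rw [← hh i]; abel
    simp only [LinearMap.sum_apply, this, Finset.sum_add_distrib, Finset.sum_const,
      Finset.card_range, smul_add, smul_smul, ← hc, Finset.smul_sum, Nat.cast_smul_eq_nsmul]
  obtain ⟨g, hg⟩ := hS (c • f + ∑ i ∈ Finset.range q, h i)
  refine ⟨g, ?_⟩
  have h1 : (S ^ q) f - f = (S - 1) ((∑ i ∈ Finset.range q, S ^ i) f) := by
    rw [← Module.End.mul_apply, mul_geom_sum]
    simp
  rw [h1, hsum, map_smul, LinearMap.sub_apply, Module.End.one_apply, hg, smul_smul, ← pow_succ']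

theorem pow_prime_pow_sub_self_eq_smul {S : Module.End R M} {r : R} {q : ℕ} (hq : r ∣ (q : R))
    (hS : ∀ f, ∃ h, S f - f = r • h) (l : ℕ) (f : M) :
    ∃ h, (S ^ q ^ l) f - f = r ^ (l + 1) • h := by
  induction l generalizing f with
  | zero => simpa using hS f
  | succ l ih => rw [pow_succ q, pow_mul]; exact pow_sub_self_eq_pow_succ_smul hq ih f

/-- Differencing in the exponent `m` amounts to applying `S - 1`. -/
theorem fwdDiff_iter_orbit (S : Module.End R M) (e : M →ₗ[R] R) (k m : ℕ) (f : M) :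
    Δ_[1] ^[k] (fun m : ℕ => e ((S ^ m) f)) m = e ((S ^ m) (((S - 1) ^ k) f)) := by
  induction k generalizing f with
  | zero => simp
  | succ k ih =>
    have : Δ_[1] (fun m : ℕ => e ((S ^ m) f)) = fun m : ℕ => e ((S ^ m) ((S - 1) f)) := by
      funext m
      simp [fwdDiff, pow_succ]
    rw [Function.iterate_succ_apply, this, ih, pow_succ, Module.End.mul_apply]

theorem sub_one_pow_eq_smul {S : Module.End R M} {r : R} (hS : ∀ f, ∃ h, S f - f = r • h)
    (k : ℕ) (f : M) : ∃ h, ((S - 1) ^ k) f = r ^ k • h := by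
  induction k generalizing f with
  | zero => exact ⟨f, by simp⟩
  | succ k ih =>
    obtain ⟨h, hh⟩ := hS f
    obtain ⟨h', hh'⟩ := ih h
    exact ⟨h', by
      rw [pow_succ, Module.End.mul_apply, LinearMap.sub_apply, Module.End.one_apply, hh, map_smul,
        hh', smul_smul, pow_succ']⟩

end Unipotent

/-! ### Orbits of polynomial maps -/

section PolynomialMap

variable {R σ : Type*} [CommRing R]

/-- Modulo `r`, substituting `P` is an algebra map fixing the variables, hence the identity. -/
theorem C_dvd_aeval_sub {P : σ → MvPolynomial σ R} {r : R}
    (hP : ∀ i, MvPolynomial.C r ∣ P i - MvPolynomial.X i) (f : MvPolynomial σ R) :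
    MvPolynomial.C r ∣ MvPolynomial.aeval P f - f := by
  have key : (Ideal.Quotient.mkₐ R (Ideal.span {MvPolynomial.C (σ := σ) r})).comp
      (MvPolynomial.aeval P) = Ideal.Quotient.mkₐ R (Ideal.span {MvPolynomial.C (σ := σ) r}) := by
    ext i
    simpa [Ideal.Quotient.eq, Ideal.mem_span_singleton] using hP i
  have := DFunLike.congr_fun key f
  simpa [Ideal.Quotient.eq, Ideal.mem_span_singleton] using this

theorem eval_iterate_aeval (P : σ → MvPolynomial σ R) (ω : σ → R) (m : ℕ) (f : MvPolynomial σ R) :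
    MvPolynomial.eval ω (((MvPolynomial.aeval P).toLinearMap ^ m : Module.End R _) f) =
      MvPolynomial.eval ((fun y i => MvPolynomial.eval y (P i))^[m] ω) f := by
  induction m generalizing f with
  | zero => simp
  | succ m ih =>
    have h (y : σ → R) : (MvPolynomial.eval y).comp (MvPolynomial.aeval P).toRingHom =
        MvPolynomial.eval fun i => MvPolynomial.eval y (P i) :=
      MvPolynomial.ringHom_ext (by simp) (by simp)
    rw [pow_succ, Module.End.mul_apply, ih, Function.iterate_succ_apply']
    exact DFunLike.congr_fun (h _) f

/-- The forward differences of an orbit of a polynomial map congruent to the identity modulo a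
divisor `r` of `q`, sampled at the multiples of `q ^ l`. -/
theorem pow_dvd_fwdDiff_iter_polynomial_orbit {P : σ → MvPolynomial σ R} {r : R} {q : ℕ}
    (hq : r ∣ (q : R)) (hP : ∀ i, MvPolynomial.C r ∣ P i - MvPolynomial.X i) (ω : σ → R)
    (l k : ℕ) (i : σ) :
    r ^ ((l + 1) * k) ∣
      Δ_[1] ^[k] (fun m : ℕ => (fun y i => MvPolynomial.eval y (P i))^[q ^ l * m] ω i) 0 := by
  have hT : ∀ f, ∃ h, (MvPolynomial.aeval P).toLinearMap f - f = r • h := fun f => by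
    obtain ⟨h, hh⟩ := C_dvd_aeval_sub hP f
    exact ⟨h, by rw [MvPolynomial.smul_eq_C_mul, ← hh]; rfl⟩
  obtain ⟨h, hh⟩ :=
    sub_one_pow_eq_smul (pow_prime_pow_sub_self_eq_smul hq hT l) k (MvPolynomial.X i)
  have h1 := fwdDiff_iter_orbit ((MvPolynomial.aeval P).toLinearMap ^ q ^ l)
    (MvPolynomial.aeval ω).toLinearMap k 0 (MvPolynomial.X i)
  have hev (f : MvPolynomial σ R) :
      (MvPolynomial.aeval ω).toLinearMap f = MvPolynomial.eval ω f := by simp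
  simp only [← pow_mul, hev, eval_iterate_aeval, MvPolynomial.eval_X] at h1
  rw [h1, hh]
  simp [← pow_mul]

end PolynomialMap

/-! ### Mahler series and their conversion to power series -/

section Interpolation

variable {p : ℕ} [Fact p.Prime] {L : Type*} [NormedField L] [NormedAlgebra ℚ_[p] L]

theorem exists_mahler_interpolation [CompleteSpace L] (v : ℕ → L)
    (hv : Tendsto (fun k => Δ_[1] ^[k] v 0) atTop (𝓝 0)) :
    ∃ G : C(ℤ_[p], L), (∀ m : ℕ, G m = v m) ∧
      ∀ w : ℤ_[p], HasSum (fun k => algebraMap ℚ_[p] L (Ring.choose w k : ℤ_[p]) *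
        Δ_[1] ^[k] v 0) (G w) := by
  have := isUltrametricDist p L
  let _ : Module ℤ_[p] L := Module.compHom L (algebraMap ℤ_[p] ℚ_[p])
  have hsmul : ∀ (z : ℤ_[p]) (x : L), z • x = algebraMap ℚ_[p] L (z : ℚ_[p]) * x :=
    fun z x => Algebra.smul_def (z : ℚ_[p]) x
  have : IsBoundedSMul ℤ_[p] L := IsBoundedSMul.of_norm_smul_le fun z x => by
    rw [hsmul, norm_mul, norm_algebraMap', PadicInt.norm_def]
  refine ⟨PadicInt.mahlerSeries (fun k => Δ_[1] ^[k] v 0), fun m => ?_, fun w => ?_⟩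
  · rw [PadicInt.mahlerSeries_apply_nat hv le_rfl]
    simpa using (shift_eq_sum_fwdDiff_iter 1 v m 0).symm
  · have h := ContinuousMap.hasSum_apply (PadicInt.hasSum_mahlerSeries hv) w
    simpa only [PadicInt.mahlerTerm_apply, hsmul, mahler_apply] using h

/-- Legendre's formula gives `v_p(k!) ≤ k`, for `p = 2` as well. -/
theorem inv_pow_le_norm_factorial (k : ℕ) : ((p : ℝ)⁻¹) ^ k ≤ ‖(k.factorial : ℚ_[p])‖ := by
  have hp : p.Prime := Fact.out
  rw [Padic.norm_eq_zpow_neg_valuation (mod_cast k.factorial_ne_zero), Padic.valuation_natCast,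
    zpow_neg, zpow_natCast, inv_pow]
  have hle : padicValNat p k.factorial ≤ k := by
    have h := sub_one_mul_padicValNat_factorial (p := p) k
    have h2 : 1 * padicValNat p k.factorial ≤ (p - 1) * padicValNat p k.factorial :=
      Nat.mul_le_mul_right _ (by have := hp.two_le; omega)
    omega
  have hp1 : (1 : ℝ) ≤ p := mod_cast hp.one_le
  gcongr

theorem choose_eq_sum_div_factorial (w : ℤ_[p]) (k : ℕ) {s : Finset ℕ}
    (hs : Finset.range (k + 1) ⊆ s) :
    ((Ring.choose w k : ℤ_[p]) : ℚ_[p]) =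
      (∑ m ∈ s, ((descPochhammer ℤ k).coeff m : ℚ_[p]) * (w : ℚ_[p]) ^ m) /
        (k.factorial : ℚ_[p]) := by
  rw [eq_div_iff (mod_cast k.factorial_ne_zero)]
  have h := Ring.descPochhammer_eq_factorial_smul_choose w k
  rw [Polynomial.smeval_eq_sum, Polynomial.sum_def,
    Finset.sum_subset (s₂ := s) (fun m hm => hs (Finset.mem_range.2 (Nat.lt_succ_of_le
      ((Polynomial.le_natDegree_of_mem_supp m hm).trans
        (descPochhammer_natDegree ℤ k).le)))) (fun m _ hm => by
      simp [Polynomial.smul_pow, Polynomial.notMem_support_iff.1 hm])] at h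
  have h' := congrArg PadicInt.Coe.ringHom h
  simp only [Polynomial.smul_pow, nsmul_eq_mul, zsmul_eq_mul, map_sum, map_mul, map_pow,
    map_intCast, map_natCast] at h'
  exact (mul_comm _ _).trans h'.symm

/-- A Mahler series whose coefficients decay at least as fast as `p ^ (-2 k)` is a power series. -/
theorem exists_hasSum_pow_of_mahler [CompleteSpace L] {c : ℕ → L}
    (hc : ∀ k, ‖c k‖ ≤ (((p : ℝ) ^ 2)⁻¹) ^ k) {G : ℤ_[p] → L}
    (hG : ∀ w, HasSum (fun k => algebraMap ℚ_[p] L (Ring.choose w k : ℤ_[p]) * c k) (G w)) :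
    ∃ a : ℕ → L, ∀ w : ℤ_[p], HasSum (fun m => a m * algebraMap ℚ_[p] L (w : ℚ_[p]) ^ m) (G w) := by
  have := isUltrametricDist p L
  have hp : p.Prime := Fact.out
  have hp1 : (1 : ℝ) < p := mod_cast hp.one_lt
  have hp0 : (0 : ℝ) < p := zero_lt_one.trans hp1
  -- `A (k, m)` is the coefficient of `w ^ m` in the `k`-th Mahler term. Dividing by `k!` costs at
  -- most `p ^ k`, so decay `p ^ (-k)` remains.
  let A : ℕ × ℕ → L := fun x => c x.1 *
    algebraMap ℚ_[p] L ((descPochhammer ℤ x.1).coeff x.2 / (x.1.factorial : ℚ_[p]))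
  have hA0 : ∀ k m, k < m → A (k, m) = 0 := fun k m h => by
    have : (descPochhammer ℤ k).coeff m = 0 :=
      Polynomial.coeff_eq_zero_of_natDegree_lt (by rwa [descPochhammer_natDegree])
    simp [A, this]
  have hA : ∀ k m, ‖A (k, m)‖ ≤ ((p : ℝ)⁻¹) ^ k := fun k m => by
    have hf := inv_pow_le_norm_factorial (p := p) k
    have hf0 : 0 < ((p : ℝ)⁻¹) ^ k := by positivity
    have hn : ‖((descPochhammer ℤ k).coeff m : ℚ_[p])‖ ≤ 1 := Padic.norm_int_le_one _
    simp only [A, norm_mul, norm_algebraMap', norm_div]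
    calc ‖c k‖ * (‖((descPochhammer ℤ k).coeff m : ℚ_[p])‖ / ‖(k.factorial : ℚ_[p])‖)
        ≤ (((p : ℝ) ^ 2)⁻¹) ^ k * (1 / ((p : ℝ)⁻¹) ^ k) := by
          gcongr
          exact hc k
      _ = ((p : ℝ)⁻¹) ^ k := by
          rw [← inv_pow, ← pow_mul, mul_comm 2 k, pow_mul, one_div, sq,
            mul_assoc, mul_inv_cancel₀ hf0.ne', mul_one]
  -- The array is supported on `m ≤ k`, so decay in `k` alone leaves finitely many large terms.
  have hsum : ∀ W : L, ‖W‖ ≤ 1 → Summable fun x : ℕ × ℕ => A x * W ^ x.2 := fun W hW => by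
    refine NonarchimedeanAddGroup.summable_of_tendsto_cofinite_zero ?_
    rw [tendsto_zero_iff_norm_tendsto_zero, Metric.tendsto_nhds]
    intro ε hε
    obtain ⟨K, hK⟩ := exists_pow_lt_of_lt_one hε (inv_lt_one_of_one_lt₀ hp1)
    refine Filter.eventually_cofinite.2 (Set.Finite.subset
      (Finset.range K ×ˢ Finset.range K).finite_toSet fun x hx => ?_)
    obtain ⟨k, m⟩ := x
    by_contra hmem
    refine hx ?_
    simp only [Finset.coe_product, Finset.coe_range, Set.mem_prod, Set.mem_Iio, not_and_or,
      not_lt] at hmem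
    rw [dist_zero_right, norm_norm, norm_mul, norm_pow]
    rcases lt_or_ge k m with hkm | hkm
    · rw [hA0 k m hkm]
      simpa using hε
    · have hKk : K ≤ k := by omega
      calc ‖A (k, m)‖ * ‖W‖ ^ m ≤ ((p : ℝ)⁻¹) ^ k * 1 := by
            gcongr
            · exact hA k m
            · exact pow_le_one₀ (norm_nonneg _) hW
        _ ≤ ((p : ℝ)⁻¹) ^ K := by
            rw [mul_one]
            exact pow_le_pow_of_le_one (by positivity) (inv_le_one_of_one_le₀ hp1.le) hKk
        _ < ε := hK
  refine ⟨fun m => ∑' k, A (k, m), fun w => ?_⟩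
  set W := algebraMap ℚ_[p] L (w : ℚ_[p]) with hWdef
  have hW : ‖W‖ ≤ 1 := by
    rw [hWdef, norm_algebraMap']
    exact w.norm_le_one
  have hrow : ∀ k, HasSum (fun m => A (k, m) * W ^ m)
      (algebraMap ℚ_[p] L (Ring.choose w k : ℤ_[p]) * c k) := fun k => by
    have h : algebraMap ℚ_[p] L (Ring.choose w k : ℤ_[p]) * c k =
        ∑ m ∈ Finset.range (k + 1), A (k, m) * W ^ m := by
      rw [choose_eq_sum_div_factorial w k subset_rfl, Finset.sum_div, map_sum, Finset.sum_mul]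
      refine Finset.sum_congr rfl fun m _ => ?_
      simp only [A, hWdef, map_div₀, map_mul, map_pow]
      ring
    rw [h]
    refine hasSum_sum_of_ne_finset_zero fun m hm => ?_
    rw [hA0 k m (by simpa using hm), zero_mul]
  -- Summing by rows gives the Mahler series, by columns the power series; `W = 1` shows that the
  -- column coefficients converge.
  have htot := (hsum W hW).hasSum
  have hval := (htot.prod_fiberwise hrow).unique (hG w)
  have hswap := (Equiv.prodComm ℕ ℕ).hasSum_iff.2 htot
  have hcol : Summable (A ∘ Equiv.prodComm ℕ ℕ) :=
    (Equiv.prodComm ℕ ℕ).summable_iff.2 (by simpa using hsum 1 (by simp))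
  rw [hval] at hswap
  exact hswap.prod_fiberwise fun m => (hcol.prod_factor m).hasSum.mul_right _

end Interpolation
theorem norm_fwdDiff_iter_le {E : Type*} [SeminormedAddCommGroup E] [IsUltrametricDist E]
    {f : ℕ → E} {ε : ℝ} (hf : ∀ m, ‖f m‖ ≤ ε) (k m : ℕ) : ‖Δ_[1] ^[k] f m‖ ≤ ε := by
  induction k generalizing f with
  | zero => exact hf m
  | succ k ih =>
    exact ih fun m => by
      rw [fwdDiff, sub_eq_add_neg]
      refine (IsUltrametricDist.norm_add_le_max _ _).trans (max_le (hf _) ?_)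
      rw [norm_neg]
      exact hf _

/-! ### Norm and divisibility in the ring of integers -/

section Integers

variable {p : ℕ} [Fact p.Prime] {L : Type*} [NormedField L] [NormedAlgebra ℚ_[p] L]

instance : IsUltrametricDist (integers p L) :=
  have := isUltrametricDist p L
  IsUltrametricDist.subtype _

/-- The ideal of integers of norm at most `ε`. -/
def normLEIdeal (p : ℕ) [Fact p.Prime] (L : Type*) [NormedField L] [NormedAlgebra ℚ_[p] L]
    {ε : ℝ} (hε : 0 ≤ ε) : Ideal (integers p L) where
  carrier := {x | ‖x‖ ≤ ε}
  zero_mem' := by simpa using hε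
  add_mem' ha hb := (IsUltrametricDist.norm_add_le_max _ _).trans (max_le ha hb)
  smul_mem' c x hx := by
    refine (norm_mul_le c x).trans ?_
    exact (mul_le_of_le_one_left (norm_nonneg _) (norm_le_one c)).trans hx

theorem mem_normLEIdeal {ε : ℝ} (hε : 0 ≤ ε) {x : integers p L} :
    x ∈ normLEIdeal p L hε ↔ ‖x‖ ≤ ε := Iff.rfl

theorem norm_mul_integers (x y : integers p L) : ‖x * y‖ = ‖x‖ * ‖y‖ :=
  norm_mul (x : L) (y : L)

theorem norm_pow_integers (x : integers p L) (k : ℕ) : ‖x ^ k‖ = ‖x‖ ^ k :=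
  norm_pow (x : L) k

theorem dvd_iff_norm_le {r x : integers p L} (hr : r ≠ 0) : r ∣ x ↔ ‖x‖ ≤ ‖r‖ := by
  constructor
  · rintro ⟨c, rfl⟩
    rw [norm_mul_integers]
    exact mul_le_of_le_one_right (norm_nonneg _) (norm_le_one c)
  · intro h
    have hr0 : (r : L) ≠ 0 := fun h0 => hr (Subtype.ext h0)
    refine ⟨⟨(x : L) / r, ?_⟩, Subtype.ext ?_⟩
    · change ‖(x : L) / r‖ ≤ 1
      rw [norm_div]
      exact div_le_one_of_le₀ h (norm_nonneg _)
    · simp [mul_div_cancel₀ _ hr0]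

theorem norm_natCast_prime : ‖((p : ℕ) : integers p L)‖ = (p : ℝ)⁻¹ := by
  change ‖(((p : ℕ) : integers p L) : L)‖ = _
  rw [Subring.coe_natCast, ← map_natCast (algebraMap ℚ_[p] L) p, norm_algebraMap', Padic.norm_p]

theorem mem_maximalIdeal_iff {x : integers p L} :
    x ∈ IsLocalRing.maximalIdeal (integers p L) ↔ ‖x‖ < 1 := by
  rw [IsLocalRing.mem_maximalIdeal, mem_nonunits_iff, isUnit_iff_norm_eq_one]
  exact ⟨fun h => lt_of_le_of_ne (norm_le_one x) h, fun h => h.ne⟩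

theorem IsUniformizer.mem_iff_dvd {r x : integers p L} (hr : IsUniformizer r) :
    x ∈ IsLocalRing.maximalIdeal (integers p L) ↔ r ∣ x := by
  rw [hr, Ideal.mem_span_singleton]

theorem IsUniformizer.dvd_natCast_prime {r : integers p L} (hr : IsUniformizer r) :
    r ∣ ((p : ℕ) : integers p L) := by
  rw [← hr.mem_iff_dvd, mem_maximalIdeal_iff, norm_natCast_prime]
  exact inv_lt_one_of_one_lt₀ (mod_cast (Fact.out : p.Prime).one_lt)

theorem IsUniformizer.ne_zero {r : integers p L} (hr : IsUniformizer r) : r ≠ 0 := by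
  rintro rfl
  have h := norm_natCast_prime (p := p) (L := L)
  rw [zero_dvd_iff.1 hr.dvd_natCast_prime, norm_zero] at h
  exact (inv_ne_zero (mod_cast (Fact.out : p.Prime).ne_zero)) h.symm

theorem IsUniformizer.norm_lt_one {r : integers p L} (hr : IsUniformizer r) : ‖r‖ < 1 :=
  mem_maximalIdeal_iff.1 (hr.mem_iff_dvd.2 dvd_rfl)

theorem norm_tsum_sub_sum_le {ι : Type*} {t : ι → integers p L} (ht : Summable t) (S : Finset ι)
    {ε : ℝ} (hε : 0 ≤ ε) (h : ∀ k ∉ S, ‖t k‖ ≤ ε) : ‖∑' k, t k - ∑ k ∈ S, t k‖ ≤ ε := by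
  rw [← ht.sum_add_tsum_compl (s := S), add_sub_cancel_left]
  exact IsUltrametricDist.norm_tsum_le_of_forall_le_of_nonneg hε fun k => h k k.2

/-! ### Convergent power series and their orbits -/

section Eval

variable {n : ℕ} {f : MvPowerSeries (Fin n) (integers p L)}

theorem norm_term_le (x : Fin n → integers p L) (k : Fin n →₀ ℕ) :
    ‖term f x k‖ ≤ ‖MvPowerSeries.coeff k f‖ := by
  rw [term, norm_mul_integers]
  exact mul_le_of_le_one_right (norm_nonneg _) (norm_le_one _)

/-- Congruent points give congruent terms modulo the ideal of elements of norm at most `ε`. -/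
theorem norm_eval_sub_eval_le (hf : Converges f) {x y : Fin n → integers p L} {ε : ℝ} (hε : 0 ≤ ε)
    (h : ∀ j, ‖x j - y j‖ ≤ ε) : ‖eval f x - eval f y‖ ≤ ε := by
  rw [eval, eval, ← (hf x).tsum_sub (hf y)]
  refine IsUltrametricDist.norm_tsum_le_of_forall_le_of_nonneg hε fun k => ?_
  rw [term, term, ← mul_sub]
  refine (mem_normLEIdeal hε).1 (Ideal.mul_mem_left _ _ ?_)
  have hj (j) : Ideal.Quotient.mk (normLEIdeal p L hε) (x j) = Ideal.Quotient.mk _ (y j) :=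
    Ideal.Quotient.eq.2 (h j)
  rw [← Ideal.Quotient.eq]
  simp only [map_prod, map_pow, hj]

theorem continuous_eval (hf : Converges f) : Continuous (eval f) :=
  (LipschitzWith.of_dist_le_mul (K := 1) fun x y => by
    rw [NNReal.coe_one, one_mul, dist_eq_norm, dist_eq_norm]
    exact norm_eval_sub_eval_le hf (norm_nonneg _) (norm_le_pi_norm (x - y))).continuous

/-- Modulo `r` the series is affine, so its values at `0` and at the unit vectors determine its
coefficients. -/
theorem dvd_coeff_sub_coeff_X {r : integers p L} (hr : r ≠ 0) (hf : Converges f) {i : Fin n}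
    (hmod : ∀ x, r ∣ eval f x - x i) (hdvd : ∀ k : Fin n →₀ ℕ, 1 < k.degree →
      r ∣ MvPowerSeries.coeff k f) (m : Fin n →₀ ℕ) :
    r ∣ MvPowerSeries.coeff m f - MvPolynomial.coeff m (MvPolynomial.X i) := by
  classical
  have hterm (j : Fin n) : MvPolynomial.coeff (Finsupp.single j 1)
      (MvPolynomial.X i : MvPolynomial (Fin n) (integers p L)) =
        (Pi.single j 1 : Fin n → integers p L) i := by
    rw [MvPolynomial.coeff_X, Pi.single_apply]
    simp [Finsupp.single_left_inj]
  have h0 : r ∣ MvPowerSeries.coeff 0 f := by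
    have h := norm_tsum_sub_sum_le (hf 0) {0} le_rfl fun k hk => by
      obtain ⟨j, hj⟩ := Finsupp.ne_iff.1 (by simpa using hk)
      rw [term, Finset.prod_eq_zero (Finset.mem_univ j) (by simpa using hj), mul_zero, norm_zero]
    rw [norm_le_zero_iff, sub_eq_zero, Finset.sum_singleton, term] at h
    have h' := hmod 0
    rw [eval, h] at h'
    simpa using h'
  rcases lt_or_ge 1 m.degree with hm | hm
  · have hX : MvPolynomial.coeff m
        (MvPolynomial.X i : MvPolynomial (Fin n) (integers p L)) = 0 := by
      rw [MvPolynomial.coeff_X, if_neg]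
      rintro rfl
      simp at hm
    rw [hX, sub_zero]
    exact hdvd m hm
  rcases Nat.le_one_iff_eq_zero_or_eq_one.1 hm with hm | hm
  · rw [Finsupp.degree_eq_zero_iff] at hm
    subst hm
    simpa using h0
  obtain ⟨j, rfl⟩ := (Finsupp.sum_eq_one_iff _).1 hm
  have h := norm_tsum_sub_sum_le (hf (Pi.single j 1)) {0, Finsupp.single j 1} (norm_nonneg r)
    fun k hk => by
      simp only [Finset.mem_insert, Finset.mem_singleton, not_or] at hk
      rcases lt_or_ge 1 k.degree with hk1 | hk1
      · exact (norm_term_le _ k).trans ((dvd_iff_norm_le hr).1 (hdvd k hk1))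
      · rcases Nat.le_one_iff_eq_zero_or_eq_one.1 hk1 with hk1 | hk1
        · exact absurd ((Finsupp.degree_eq_zero_iff _).1 hk1) hk.1
        · obtain ⟨j', rfl⟩ := (Finsupp.sum_eq_one_iff _).1 hk1
          have hne : j' ≠ j := fun h => hk.2 (by rw [h])
          rw [term, Finset.prod_eq_zero (Finset.mem_univ j') (by simp [hne]), mul_zero, norm_zero]
          exact norm_nonneg r
  have hprod : ∏ x, (Pi.single j 1 : Fin n → integers p L) x ^ (Finsupp.single j 1) x = 1 :=
    Finset.prod_eq_one fun x _ => by
      by_cases hx : x = j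
      · subst hx; simp
      · simp [Ne.symm hx]
  rw [Finset.sum_pair (Finsupp.single_ne_zero.2 one_ne_zero).symm, ← dvd_iff_norm_le hr, term, term,
    hprod] at h
  rw [hterm]
  convert dvd_sub (dvd_sub (hmod (Pi.single j 1)) h) h0 using 1
  simp only [eval, Finsupp.coe_zero, Pi.zero_apply, pow_zero, Finset.prod_const_one, mul_one]
  ring

theorem exists_polynomial_approx (hf : Converges f) {ε : ℝ} (hε : 0 < ε) :
    ∃ P : MvPolynomial (Fin n) (integers p L),
      (∀ x, ‖eval f x - MvPolynomial.eval x P‖ ≤ ε) ∧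
      ∀ m, ‖MvPolynomial.coeff m P - MvPowerSeries.coeff m f‖ ≤ ε := by
  classical
  have hfin : {k | ¬ ‖MvPowerSeries.coeff k f‖ < ε}.Finite := by
    -- At the point `(1, …, 1)` the terms are the coefficients themselves, which therefore tend to
    -- zero.
    have h := (hf 1).tendsto_cofinite_zero.norm
    rw [norm_zero] at h
    have h' := Filter.eventually_cofinite.1 (h.eventually_lt_const hε)
    simpa [term] using h'
  have hS : ∀ k ∉ hfin.toFinset, ‖MvPowerSeries.coeff k f‖ ≤ ε := fun k hk => by
    have : ‖MvPowerSeries.coeff k f‖ < ε := by simpa using hk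
    exact this.le
  refine ⟨∑ k ∈ hfin.toFinset, MvPolynomial.monomial k (MvPowerSeries.coeff k f),
    fun x => ?_, fun m => ?_⟩
  · have h := norm_tsum_sub_sum_le (hf x) hfin.toFinset hε.le
      fun k hk => (norm_term_le x k).trans (hS k hk)
    rw [map_sum]
    simp only [MvPolynomial.eval_monomial, Finsupp.prod_fintype, pow_zero, implies_true]
    exact h
  · simp only [MvPolynomial.coeff_sum, MvPolynomial.coeff_monomial, Finset.sum_ite_eq']
    split_ifs with hm
    · simpa using hε.le
    · simpa using hS m hm

/-- The value at `y` of the analytic map with components `φ`. -/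
def evalMap (φ : Fin n → MvPowerSeries (Fin n) (integers p L)) (y : Fin n → integers p L) :
    Fin n → integers p L :=
  fun i => eval (φ i) y

/-- `evalMap φ` is 1-Lipschitz and the norm ultrametric, so errors do not accumulate under
iteration. -/
theorem norm_iterate_evalMap_sub_le {φ : Fin n → MvPowerSeries (Fin n) (integers p L)}
    (hφ : ∀ i, Converges (φ i)) {Ψ : (Fin n → integers p L) → Fin n → integers p L} {ε : ℝ}
    (hε : 0 ≤ ε) (h : ∀ y i, ‖evalMap φ y i - Ψ y i‖ ≤ ε) (ω : Fin n → integers p L) (m : ℕ)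
    (i : Fin n) : ‖(evalMap φ)^[m] ω i - Ψ^[m] ω i‖ ≤ ε := by
  induction m generalizing i with
  | zero => simpa using hε
  | succ m ih =>
    rw [Function.iterate_succ_apply', Function.iterate_succ_apply',
      ← sub_add_sub_cancel _ (evalMap φ (Ψ^[m] ω) i)]
    exact (IsUltrametricDist.norm_add_le_max _ _).trans
      (max_le (norm_eval_sub_eval_le (hφ i) hε ih) (h _ i))

theorem norm_fwdDiff_iter_orbit_le {r : integers p L} (hr : IsUniformizer r)
    {φ : Fin n → MvPowerSeries (Fin n) (integers p L)} (hφ : ∀ i, Converges (φ i))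
    (hcoeff : ∀ i m, r ∣ MvPowerSeries.coeff m (φ i) - MvPolynomial.coeff m (MvPolynomial.X i))
    (ω : Fin n → integers p L) (l k : ℕ) (i : Fin n) :
    ‖Δ_[1] ^[k] (fun m : ℕ => (evalMap φ)^[p ^ l * m] ω i) 0‖ ≤ ‖r‖ ^ ((l + 1) * k) := by
  have hr0 : 0 < ‖r‖ := norm_pos_iff.2 hr.ne_zero
  -- The approximation may depend on `k`. The extra `+ 1` keeps `P` congruent to the identity modulo
  -- `r` even when `k = 0`.
  have hε : 0 < ‖r‖ ^ ((l + 1) * k + 1) := pow_pos hr0 _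
  choose P hP hPc using fun i => exists_polynomial_approx (hφ i) hε
  have hX : ∀ i, MvPolynomial.C r ∣ P i - MvPolynomial.X i := fun i => by
    rw [MvPolynomial.C_dvd_iff_dvd_coeff]
    intro m
    rw [MvPolynomial.coeff_sub, ← sub_add_sub_cancel _ (MvPowerSeries.coeff m (φ i))]
    refine dvd_add ((dvd_iff_norm_le hr.ne_zero).2 ((hPc i m).trans ?_)) (hcoeff i m)
    exact pow_le_of_le_one hr0.le hr.norm_lt_one.le (Nat.succ_ne_zero _)
  have h1 := pow_dvd_fwdDiff_iter_polynomial_orbit hr.dvd_natCast_prime hX ω l k i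
  rw [dvd_iff_norm_le (pow_ne_zero _ hr.ne_zero), norm_pow_integers] at h1
  set Ψ := fun (y : Fin n → integers p L) i => MvPolynomial.eval y (P i)
  have h2 := norm_fwdDiff_iter_le (ε := ‖r‖ ^ ((l + 1) * k)) (fun m =>
    (norm_iterate_evalMap_sub_le hφ (Ψ := Ψ) hε.le (fun y i => hP i y) ω (p ^ l * m) i).trans
      (pow_le_pow_of_le_one hr0.le hr.norm_lt_one.le (Nat.le_succ _))) k 0
  have h3 := fwdDiff_iter_add 1 (fun m : ℕ => (evalMap φ)^[p ^ l * m] ω i - Ψ^[p ^ l * m] ω i)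
    (fun m : ℕ => Ψ^[p ^ l * m] ω i) k
  have h4 : ((fun m : ℕ => (evalMap φ)^[p ^ l * m] ω i - Ψ^[p ^ l * m] ω i) +
    fun m : ℕ => Ψ^[p ^ l * m] ω i) = fun m : ℕ => (evalMap φ)^[p ^ l * m] ω i := by
    funext m; simp
  rw [h4] at h3
  rw [h3]
  exact (IsUltrametricDist.norm_add_le_max _ _).trans (max_le h2 h1)

end Eval

theorem coe_fwdDiff_iter (v : ℕ → integers p L) (k m : ℕ) :
    ((Δ_[1] ^[k] v m : integers p L) : L) = Δ_[1] ^[k] (fun m => (v m : L)) m := by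
  induction k generalizing v with
  | zero => rfl
  | succ k ih => exact ih _

/-- A sequence of integers whose `k`-th forward differences at `0` decay geometrically extends
continuously to `ℤ_[p]`, by a power series if the decay is fast enough. -/
theorem exists_interpolation [CompleteSpace L] {v : ℕ → integers p L} {ρ : ℝ}
    (hρ1 : ρ < 1) (hv : ∀ k, ‖Δ_[1] ^[k] v 0‖ ≤ ρ ^ k) :
    ∃ G : ℤ_[p] → integers p L, Continuous G ∧ (∀ m : ℕ, G m = v m) ∧
      (ρ ≤ ((p : ℝ) ^ 2)⁻¹ → ∃ a : ℕ → L, ∀ w : ℤ_[p],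
        HasSum (fun m => a m * algebraMap ℚ_[p] L (w : ℚ_[p]) ^ m) (G w : L)) := by
  have hρ0 : 0 ≤ ρ := by simpa using (norm_nonneg _).trans (hv 1)
  have hv' : ∀ k, ‖Δ_[1] ^[k] (fun m => (v m : L)) 0‖ ≤ ρ ^ k := fun k => by
    rw [← coe_fwdDiff_iter]
    exact hv k
  obtain ⟨G, hGv, hG⟩ := exists_mahler_interpolation (p := p) (fun m => (v m : L))
    (squeeze_zero_norm hv' (tendsto_pow_atTop_nhds_zero_of_lt_one hρ0 hρ1))
  -- Integrality passes from the dense set `ℕ` to `ℤ_[p]`, the unit ball being closed.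
  have hmem : ∀ z, ‖G z‖ ≤ 1 := fun z =>
    PadicInt.denseRange_natCast.induction_on z
      (isClosed_le G.continuous.norm continuous_const) fun m => by
        rw [hGv]
        exact norm_le_one (v m)
  refine ⟨fun z => ⟨G z, hmem z⟩, G.continuous.subtype_mk _, fun m => Subtype.ext (hGv m),
    fun h => exists_hasSum_pow_of_mahler (fun k => (hv' k).trans ?_) hG⟩
  gcongr

end Integers
end PadicArc

end

/-! ### The interpolated orbit -/

theorem mainTheorem4 (p : ℕ) [Fact p.Prime]
    (L : Type*) [NormedField L] [NormedAlgebra ℚ_[p] L] [FiniteDimensional ℚ_[p] L]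
    (r : PadicArc.integers p L) (hr : PadicArc.IsUniformizer r)
    (n : ℕ) (φ : Fin n → MvPowerSeries (Fin n) (PadicArc.integers p L))
    (hconv : ∀ i, PadicArc.Converges (φ i))
    (hmod : ∀ i, ∀ x : Fin n → PadicArc.integers p L,
      PadicArc.eval (φ i) x - x i ∈ IsLocalRing.maximalIdeal (PadicArc.integers p L))
    (hdvd : ∀ i, ∀ k : Fin n →₀ ℕ, 1 < k.degree →
      r ^ (k.degree - 1) ∣ MvPowerSeries.coeff k (φ i))
    (ω : Fin n → PadicArc.integers p L) :
    ∃ g : Fin n → ℤ_[p] → PadicArc.integers p L,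
      (∀ i, Continuous (g i)) ∧
      (∃ l : ℕ, 0 < l ∧ ∀ i, PadicArc.AnalyticOnPow l (g i)) ∧
      (∀ i, g i 0 = ω i) ∧
      (∀ i, ∀ z : ℤ_[p], g i (z + 1) = PadicArc.eval (φ i) (fun j => g j z)) := by
  have : CompleteSpace L := FiniteDimensional.complete ℚ_[p] L
  have hp0 : (0 : ℝ) < p := mod_cast (Fact.out : p.Prime).pos
  have hcoeff : ∀ i m, r ∣ MvPowerSeries.coeff m (φ i) -
      MvPolynomial.coeff m (MvPolynomial.X i) := fun i =>
    PadicArc.dvd_coeff_sub_coeff_X hr.ne_zero (hconv i) (fun x => hr.mem_iff_dvd.1 (hmod i x))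
      fun k hk => (dvd_pow_self r (by omega)).trans (hdvd i k hk)
  have hdiff := PadicArc.norm_fwdDiff_iter_orbit_le hr hconv hcoeff ω
  simp only [pow_mul] at hdiff
  have hlt (l : ℕ) : ‖r‖ ^ (l + 1) < 1 :=
    pow_lt_one₀ (norm_nonneg r) hr.norm_lt_one (Nat.succ_ne_zero l)
  choose G hGc hGv hGa using fun l i =>
    PadicArc.exists_interpolation (hlt l) (fun k => hdiff l k i)
  have hG0 (i : Fin n) (m : ℕ) : G 0 i m = (PadicArc.evalMap φ)^[m] ω i := by
    rw [hGv]
    simp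
  refine ⟨G 0, hGc 0, ?_, fun i => by simpa using hG0 i 0, fun i => ?_⟩
  · obtain ⟨l, hl⟩ := exists_pow_lt_of_lt_one (show (0 : ℝ) < ((p : ℝ) ^ 2)⁻¹ by positivity)
      hr.norm_lt_one
    have hl' : ‖r‖ ^ (l + 1 + 1) ≤ ((p : ℝ) ^ 2)⁻¹ :=
      (pow_le_pow_of_le_one (norm_nonneg r) hr.norm_lt_one.le (by omega)).trans hl.le
    refine ⟨l + 1, l.succ_pos, fun i => ?_⟩
    -- Both sides are continuous and interpolate the orbit sampled along `p ^ (l + 1) ℕ`, so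
    -- analyticity of `G (l + 1)` transfers to `G 0` after rescaling.
    have hscale : (fun w : ℤ_[p] => G 0 i ((p : ℤ_[p]) ^ (l + 1) * w)) = G (l + 1) i :=
      PadicInt.denseRange_natCast.equalizer ((hGc 0 i).comp (continuous_const_mul _))
        (hGc (l + 1) i) <| funext fun m => by
          have h := hG0 i (p ^ (l + 1) * m)
          push_cast at h
          exact h.trans (hGv (l + 1) i m).symm
    obtain ⟨a, ha⟩ := hGa (l + 1) i hl'
    have hpL : algebraMap ℚ_[p] L (p : ℚ_[p]) ≠ 0 :=
      (map_ne_zero _).2 (mod_cast (Fact.out : p.Prime).ne_zero)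
    refine ⟨fun m => a m / (algebraMap ℚ_[p] L (p : ℚ_[p]) ^ (l + 1)) ^ m, fun z hz => ?_⟩
    obtain ⟨w, rfl⟩ := Ideal.mem_span_singleton.1 hz
    rw [show G 0 i ((p : ℤ_[p]) ^ (l + 1) * w) = G (l + 1) i w from congrFun hscale w]
    convert! ha w using 2 with m
    simp only [PadicInt.coe_mul, PadicInt.coe_pow, PadicInt.coe_natCast, map_mul, map_pow,
      mul_pow]
    field_simp
  -- On `ℕ` the functional equation is the recursion defining the orbit; both sides are continuous.
  · refine congrFun (PadicInt.denseRange_natCast.equalizer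
      ((hGc 0 i).comp (continuous_add_const 1))
      ((PadicArc.continuous_eval (hconv i)).comp (continuous_pi fun j => hGc 0 j))
      (funext fun m => ?_))
    have h := hG0 i (m + 1)
    push_cast at h
    rw [Function.iterate_succ_apply'] at h
    simp only [Function.comp_apply, hG0]
    exact h
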